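/- Let $Z\sim N(0,1)$, write $\Phi h=\mathbb{E}h(Z)$ and $\|g\|=\sup_{x\in\mathbb{R}}|g(x)|$, and let $C_b^\infty(\mathbb{R})$ be the set of smooth functions $\mathbb{R}\to\mathbb{R}$ that are bounded together with all their derivatives. For every $h\in C_b^\infty(\mathbb{R})$ and all constants $\delta,C>0$ there is a constant $K$, depending only on $\delta$, $C$ and $h$, such that the following holds for every $\alpha>0$. Let $(X_n)_{n\ge 1}$ be real random variables (possibly on different probability spaces) with moments of all orders such that, for each $n$, $\mathbb{E}|X_n|^k=o(k!)$ as $k\to\infty$. Put $\epsilon_{n,k}=\mathbb{E}X_n^k-\mathbb{E}Z^k$ for $k\ge 0$, and suppose that for all $n\ge1$ and $k\geq 1$ $$\|h^{(k)}\|\,|\epsilon_{n,k}|\leq \frac{C}{n^{\alpha}}k^{-\delta}(k-1)!\quad\text{and}\quad \|h^{(k+2)}\|\,|\epsilon_{n,k}|\leq \frac{C}{n^{\alpha}}k^{-\delta}(k-1)!.$$ Then, for every $n\ge 1$, the series below converges and $$|\mathbb{E}h(X_n)-\Phi h|\leq\|h'\|\,|\epsilon_{n,1}|+\sum_{k=1}^{\infty}\frac{\|h^{(k+1)}\|}{(k+1)!}\,\big|k\epsilon_{n,k-1}-\epsilon_{n,k+1}\big|\leq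 \frac{K}{n^{\alpha}}.$$ -/

import Mathlib

open MeasureTheory ProbabilityTheory Filter Asymptotics
open scoped Nat ContDiff

/-- The supremum norm `sup_x |f x|` of a real function; it is only used for bounded functions. -/
noncomputable def supNorm (f : ℝ → ℝ) : ℝ := ⨆ x : ℝ, |f x|

/-- The class `C_b^∞(ℝ)`: smooth functions that are bounded together with all their derivatives. -/
def IsCbInfty (h : ℝ → ℝ) : Prop :=
  ContDiff ℝ ∞ h ∧ ∀ k : ℕ, ∃ M : ℝ, ∀ x : ℝ, |iteratedDeriv k h x| ≤ M

/-- The difference `E X^k - E Z^k` of the `k`-th moments of `X` and of a standard normal `Z`. -/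
noncomputable def momentDiff {Ω : Type*} [MeasurableSpace Ω] (P : Measure Ω) (X : Ω → ℝ)
    (k : ℕ) : ℝ :=
  (∫ w, X w ^ k ∂P) - ∫ z, z ^ k ∂(gaussianReal 0 1)

/-- The `k`-th term `‖h^(k+1)‖ / (k+1)! * |k ε_(k-1) - ε_(k+1)|` of the bound, for `k ≥ 1`. -/
noncomputable def boundTerm (h : ℝ → ℝ) (ε : ℕ → ℝ) (k : ℕ) : ℝ :=
  supNorm (iteratedDeriv (k + 1) h) / ((k + 1)! : ℝ) * |(k : ℝ) * ε (k - 1) - ε (k + 1)|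

/-!
Let `f` be the bounded solution of the Stein equation `f' x - x f x = h x - E h(Z)` and put
`a k = f^(k)(0)`. Differentiating the equation gives `h^(k+1)(0) = a (k+2) - (k+1) a k`, so summing
the Taylor expansion of `E h(X) - E h(Z)` by parts turns the differences `ε k` of the moments into
the combinations `k ε (k-1) - ε (k+1)`, with coefficients `a k / k!`. A Gaussian integral formula
for `a k` bounds it by `‖h^(k+1)‖ / (k+1)`, which produces the terms of the series.

The remainder of the Taylor expansion under the law of `Z` need not tend to zero for `h` itself.
Averaging `h` against a Fejér kernel at scale `σ` does not increase any `‖h^(k)‖` and forces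
`‖h^(k)‖ ≤ A (2 / σ)^k` for some `A`, which makes the remainder vanish; then let `σ → 0`.
-/

lemma supNorm_nonneg (f : ℝ → ℝ) : 0 ≤ supNorm f := Real.iSup_nonneg fun _ => abs_nonneg _

lemma supNorm_le {f : ℝ → ℝ} {B : ℝ} (hf : ∀ x, |f x| ≤ B) : supNorm f ≤ B := ciSup_le hf

lemma abs_le_supNorm {f : ℝ → ℝ} (hf : ∃ M, ∀ x, |f x| ≤ M) (x : ℝ) : |f x| ≤ supNorm f := by
  obtain ⟨M, hM⟩ := hf
  exact le_ciSup (f := fun x => |f x|) ⟨M, Set.forall_mem_range.2 hM⟩ x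

lemma iteratedDeriv_eq_of_hasDerivAt_succ {g : ℕ → ℝ → ℝ}
    (hg : ∀ k x, HasDerivAt (g k) (g (k + 1) x) x) (k : ℕ) : iteratedDeriv k (g 0) = g k := by
  induction k with
  | zero => exact iteratedDeriv_zero
  | succ k ih => rw [iteratedDeriv_succ, ih]; exact funext fun x => (hg k x).deriv

lemma contDiff_infty_of_hasDerivAt_succ {g : ℕ → ℝ → ℝ}
    (hg : ∀ k x, HasDerivAt (g k) (g (k + 1) x) x) : ContDiff ℝ ∞ (g 0) := by
  refine contDiff_of_differentiable_iteratedDeriv fun k _ => ?_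
  rw [iteratedDeriv_eq_of_hasDerivAt_succ hg]
  exact fun x => (hg k x).differentiableAt

namespace IsCbInfty

variable {f : ℝ → ℝ}

protected lemma iteratedDeriv (hf : IsCbInfty f) (k : ℕ) : IsCbInfty (iteratedDeriv k f) := by
  refine ⟨?_, fun j => ?_⟩
  · rw [iteratedDeriv_eq_iterate]
    exact hf.1.iterate_deriv k
  · obtain ⟨M, hM⟩ := hf.2 (j + k)
    refine ⟨M, fun x => ?_⟩
    rw [iteratedDeriv_eq_iterate, iteratedDeriv_eq_iterate, ← Function.iterate_add_apply,
      ← iteratedDeriv_eq_iterate]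
    exact hM x

protected lemma deriv (hf : IsCbInfty f) : IsCbInfty (deriv f) :=
  iteratedDeriv_one (f := f) ▸ hf.iteratedDeriv 1

protected lemma hasDerivAt (hf : IsCbInfty f) (x : ℝ) : HasDerivAt f (deriv f x) x :=
  (hf.1.differentiable (by simp) x).hasDerivAt

protected lemma continuous (hf : IsCbInfty f) : Continuous f := hf.1.continuous

lemma abs_le (hf : IsCbInfty f) (x : ℝ) : |f x| ≤ supNorm f :=
  abs_le_supNorm (by simpa using hf.2 0) x

lemma integrable_comp (hf : IsCbInfty f) {Ω : Type*} [MeasurableSpace Ω] {P : Measure Ω}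
    [IsFiniteMeasure P] {X : Ω → ℝ} (hX : AEMeasurable X P) : Integrable (fun w => f (X w)) P :=
  Integrable.of_bound (hf.continuous.measurable.comp_aemeasurable hX).aestronglyMeasurable
    (supNorm f) (ae_of_all _ fun _ => hf.abs_le _)

end IsCbInfty

lemma abs_sub_taylor_le {f : ℝ → ℝ} {n : ℕ} (hf : ContDiff ℝ n f) {B : ℝ}
    (hB : ∀ x, |iteratedDeriv n f x| ≤ B) (x₀ x : ℝ) :
    |f x - ∑ k ∈ Finset.range n, iteratedDeriv k f x₀ / k ! * (x - x₀) ^ k|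
      ≤ B / n ! * |x - x₀| ^ n := by
  cases n with
  | zero => simpa using hB x
  | succ n =>
    rcases eq_or_ne x₀ x with rfl | hx
    · simp [Finset.sum_range_succ']
    obtain ⟨y, -, hy⟩ := taylor_mean_remainder_lagrange_iteratedDeriv hx
      (by exact_mod_cast hf.contDiffOn)
    have hpoly : taylorWithinEval f n (Set.uIcc x₀ x) x₀ x
        = ∑ k ∈ Finset.range (n + 1), iteratedDeriv k f x₀ / k ! * (x - x₀) ^ k := by
      rw [taylor_within_apply]
      refine Finset.sum_congr rfl fun k hk => ?_
      rw [iteratedDerivWithin_eq_iteratedDeriv (uniqueDiffOn_uIcc hx)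
        (hf.contDiffAt.of_le (by exact_mod_cast (Finset.mem_range.1 hk).le)) Set.left_mem_uIcc,
        smul_eq_mul]
      ring
    rw [← hpoly, hy, abs_div, abs_mul, abs_pow, Nat.abs_cast, div_mul_eq_mul_div]
    gcongr
    exact hB y

section Gaussian

lemma hasDerivAt_gaussianPDFReal (μ : ℝ) (v : NNReal) (x : ℝ) :
    HasDerivAt (gaussianPDFReal μ v) (-((x - μ) / v * gaussianPDFReal μ v x)) x := by
  have hexp : HasDerivAt (fun x => -(x - μ) ^ 2 / (2 * (v : ℝ))) (-((x - μ) / v)) x := by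
    convert! ((((hasDerivAt_id x).sub_const μ).pow 2).neg.div_const (2 * (v : ℝ))) using 1
    simp only [id, Nat.cast_ofNat, Nat.add_one_sub_one, pow_one, mul_one]
    ring
  rw [gaussianPDFReal_def]
  convert! hexp.exp.const_mul (√(2 * Real.pi * v))⁻¹ using 1
  ring

lemma integrable_gaussianReal_iff {μ : ℝ} {v : NNReal} (hv : v ≠ 0) {f : ℝ → ℝ} :
    Integrable f (gaussianReal μ v) ↔ Integrable fun x => f x * gaussianPDFReal μ v x := by
  rw [gaussianReal_of_var_ne_zero μ hv, integrable_withDensity_iff (measurable_gaussianPDF μ v)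
    (ae_of_all _ fun _ => gaussianPDF_lt_top)]
  simp only [toReal_gaussianPDF]

/-- Stein's lemma. -/
lemma integral_sub_mul_gaussianReal {μ : ℝ} {v : NNReal} {f f' : ℝ → ℝ}
    (hf : ∀ x, HasDerivAt f (f' x) x) (hfi : Integrable f (gaussianReal μ v))
    (hfi' : Integrable f' (gaussianReal μ v))
    (hxf : Integrable (fun x => (x - μ) * f x) (gaussianReal μ v)) :
    ∫ x, (x - μ) * f x ∂(gaussianReal μ v) = v * ∫ x, f' x ∂(gaussianReal μ v) := by
  rcases eq_or_ne v 0 with rfl | hv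
  · simp
  have hv' : (v : ℝ) ≠ 0 := by exact_mod_cast hv
  rw [integrable_gaussianReal_iff hv] at hfi hfi' hxf
  have hparts := integral_mul_deriv_eq_deriv_mul_of_integrable
    (fun x _ => hf x) (fun x _ => hasDerivAt_gaussianPDFReal μ v x)
    ((hxf.const_mul (-(v : ℝ)⁻¹)).congr (ae_of_all _ fun x => by
      simp only [Pi.mul_apply]; field_simp)) hfi' hfi
  simp only [integral_gaussianReal_eq_integral_smul hv, smul_eq_mul]
  simp only [mul_comm (gaussianPDFReal μ v _)]
  rw [← neg_eq_iff_eq_neg.2 hparts, ← integral_neg, ← integral_const_mul]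
  congr with x
  field_simp

lemma integrable_exp_mul_abs_gaussianReal (t : ℝ) :
    Integrable (fun z => Real.exp (t * |z|)) (gaussianReal 0 1) :=
  integrable_exp_mul_abs (X := id) (integrable_exp_mul_gaussianReal t)
    (integrable_exp_mul_gaussianReal (-t))

lemma integrable_abs_pow_gaussianReal (k : ℕ) :
    Integrable (fun z : ℝ => |z| ^ k) (gaussianReal 0 1) :=
  integrable_pow_abs_of_integrable_exp_mul (X := id) one_ne_zero
    (integrable_exp_mul_gaussianReal 1) (integrable_exp_mul_gaussianReal (-1)) k

end Gaussian

lemma tendsto_pow_mul_integral_abs_pow_div_factorial {Ω : Type*} [MeasurableSpace Ω]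
    {P : Measure Ω} {X : Ω → ℝ} (hX : AEMeasurable X P) {A : ℝ} (hA : 0 ≤ A)
    (hexp : Integrable (fun w => Real.exp (A * |X w|)) P) :
    Tendsto (fun k : ℕ => A ^ k * (∫ w, |X w| ^ k ∂P) / k !) atTop (nhds 0) := by
  have hlim : Tendsto (fun k : ℕ => ∫ w, ((A * |X w|) ^ k / k !) ∂P) atTop (nhds (∫ _, 0 ∂P)) := by
    refine tendsto_integral_of_dominated_convergence (fun w => Real.exp (A * |X w|))
      (fun k => ((hX.abs.const_mul A).pow_const k |>.div_const _).aestronglyMeasurable) hexp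
      (fun k => ae_of_all _ fun w => ?_)
      (ae_of_all _ fun w => FloorSemiring.tendsto_pow_div_factorial_atTop _)
    rw [Real.norm_of_nonneg (by positivity)]
    exact Real.pow_div_factorial_le_exp _ (by positivity) k
  simpa only [mul_pow, integral_div, integral_const_mul, integral_zero] using hlim

/-- The Gaussian smoothing `E f(s Z)`, `Z` standard normal, as a function of the scale `s`: the
solution of `u_t = u_xx` with initial datum `f`, observed at the origin at time `s ^ 2 / 2`. -/
noncomputable def gaussianMean (f : ℝ → ℝ) (s : ℝ) : ℝ := ∫ z, f (s * z) ∂(gaussianReal 0 1)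

@[simp]
lemma gaussianMean_zero (f : ℝ → ℝ) : gaussianMean f 0 = f 0 := by simp [gaussianMean]

lemma abs_gaussianMean_le {f : ℝ → ℝ} {B : ℝ} (hf : ∀ x, |f x| ≤ B) (s : ℝ) :
    |gaussianMean f s| ≤ B := by
  simpa [gaussianMean] using norm_integral_le_of_norm_le_const (μ := gaussianReal 0 1)
    (f := fun z => f (s * z)) (ae_of_all _ fun z => hf _)

namespace IsCbInfty

variable {f : ℝ → ℝ}

lemma hasDerivAt_gaussianMean (hf : IsCbInfty f) (s : ℝ) :
    HasDerivAt (gaussianMean f) (s * gaussianMean (deriv (deriv f)) s) s := by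
  have hscale (t : ℝ) : AEMeasurable (fun z => t * z) (gaussianReal 0 1) := by fun_prop
  have habs : Integrable (fun z : ℝ => |z|) (gaussianReal 0 1) := by
    simpa using integrable_abs_pow_gaussianReal 1
  have hderiv : HasDerivAt (gaussianMean f)
      (∫ z, z * deriv f (s * z) ∂(gaussianReal 0 1)) s := by
    refine (hasDerivAt_integral_of_dominated_loc_of_deriv_le (Metric.ball_mem_nhds s one_pos)
      (F' := fun t z => z * deriv f (t * z)) (bound := fun z => |z| * supNorm (deriv f))
      (Eventually.of_forall fun t => (hf.integrable_comp (hscale t)).aestronglyMeasurable)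
      (hf.integrable_comp (hscale s)) ?_ (ae_of_all _ fun z t _ => ?_) (habs.mul_const _)
      (ae_of_all _ fun z t _ => ?_)).2
    · exact (continuous_id.mul (hf.deriv.continuous.comp (by fun_prop))).aestronglyMeasurable
    · rw [Real.norm_eq_abs, abs_mul]
      gcongr
      exact hf.deriv.abs_le _
    · simpa [mul_comm, Function.comp_def] using
        (hf.hasDerivAt (t * z)).comp t (hasDerivAt_mul_const z)
  have hcomp (z : ℝ) : HasDerivAt (fun z => deriv f (s * z)) (s * deriv (deriv f) (s * z)) z := by
    simpa [mul_comm, Function.comp_def] using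
      (hf.deriv.hasDerivAt (s * z)).comp z (hasDerivAt_const_mul s)
  have hstein := integral_sub_mul_gaussianReal (μ := 0) (v := 1) hcomp
    (hf.deriv.integrable_comp (hscale s)) ((hf.deriv.deriv.integrable_comp (hscale s)).const_mul s)
    (by
      simp only [sub_zero]
      refine (habs.mul_const (supNorm (deriv f))).mono'
        (continuous_id.mul (hf.deriv.continuous.comp (by fun_prop))).aestronglyMeasurable
        (ae_of_all _ fun z => ?_)
      rw [Real.norm_eq_abs, abs_mul]
      gcongr
      exact hf.deriv.abs_le _)
  simp only [sub_zero, NNReal.coe_one, one_mul, integral_const_mul] at hstein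
  rwa [hstein] at hderiv

lemma continuous_gaussianMean (hf : IsCbInfty f) : Continuous (gaussianMean f) :=
  continuous_iff_continuousAt.2 fun s => (hf.hasDerivAt_gaussianMean s).continuousAt

end IsCbInfty

/-- The `k`-th derivative at the origin of the bounded solution `f` of the Stein equation
`f' x - x * f x = h x - E h(Z)`, obtained by differentiating under the integral sign in
`f x = -∫ θ in 0..π/2, sin θ * E h'(x cos θ + Z sin θ)`. -/
noncomputable def steinCoeff (h : ℝ → ℝ) (k : ℕ) : ℝ :=
  -∫ θ in (0 : ℝ)..(Real.pi / 2),
    Real.sin θ * Real.cos θ ^ k * gaussianMean (iteratedDeriv (k + 1) h) (Real.sin θ)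

lemma integral_sin_mul_cos_pow (k : ℕ) :
    ∫ θ in (0 : ℝ)..(Real.pi / 2), Real.sin θ * Real.cos θ ^ k = 1 / (k + 1) := by
  simpa using integral_sin_pow_odd_mul_cos_pow (a := 0) (b := Real.pi / 2) 0 k

namespace IsCbInfty

variable {h : ℝ → ℝ}

lemma abs_steinCoeff_le (hh : IsCbInfty h) (k : ℕ) :
    |steinCoeff h k| ≤ supNorm (iteratedDeriv (k + 1) h) / (k + 1) := by
  rw [steinCoeff, abs_neg, div_eq_mul_one_div (supNorm _), ← integral_sin_mul_cos_pow,
    ← intervalIntegral.integral_const_mul, ← Real.norm_eq_abs]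
  refine intervalIntegral.norm_integral_le_of_norm_le (by positivity)
    (ae_of_all _ fun θ hθ => ?_) (Continuous.intervalIntegrable (by fun_prop) _ _)
  have hsin : 0 ≤ Real.sin θ :=
    Real.sin_nonneg_of_nonneg_of_le_pi hθ.1.le (by linarith [hθ.2, Real.pi_pos])
  have hcos : 0 ≤ Real.cos θ :=
    Real.cos_nonneg_of_neg_pi_div_two_le_of_le (by linarith [hθ.1, Real.pi_pos]) hθ.2
  rw [Real.norm_eq_abs, abs_mul, abs_of_nonneg (by positivity), mul_comm]
  gcongr
  exact abs_gaussianMean_le (hh.iteratedDeriv _).abs_le _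

lemma steinCoeff_add_two_sub (hh : IsCbInfty h) (k : ℕ) :
    steinCoeff h (k + 2) - (k + 1) * steinCoeff h k = iteratedDeriv (k + 1) h 0 := by
  have hcont (j : ℕ) := (hh.iteratedDeriv j).continuous_gaussianMean
  have hderiv (θ : ℝ) : HasDerivAt
      (fun θ => Real.cos θ ^ (k + 1) * gaussianMean (iteratedDeriv (k + 1) h) (Real.sin θ))
      (Real.sin θ * Real.cos θ ^ (k + 2) * gaussianMean (iteratedDeriv (k + 3) h) (Real.sin θ)
        - (k + 1) * (Real.sin θ * Real.cos θ ^ k *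
          gaussianMean (iteratedDeriv (k + 1) h) (Real.sin θ))) θ := by
    have hmean := (hh.iteratedDeriv (k + 1)).hasDerivAt_gaussianMean (Real.sin θ)
    convert! ((Real.hasDerivAt_cos θ).pow (k + 1)).mul
      (hmean.comp θ (Real.hasDerivAt_sin θ)) using 1
    simp only [iteratedDeriv_succ, Function.comp_apply, Pi.pow_apply, Nat.cast_add, Nat.cast_one,
      Nat.add_sub_cancel]
    ring
  have hint (j : ℕ) : IntervalIntegrable (fun θ => Real.sin θ * Real.cos θ ^ j *
      gaussianMean (iteratedDeriv (j + 1) h) (Real.sin θ)) volume 0 (Real.pi / 2) :=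
    Continuous.intervalIntegrable (by fun_prop) _ _
  have hftc := intervalIntegral.integral_eq_sub_of_hasDerivAt (a := 0) (b := Real.pi / 2)
    (fun θ _ => hderiv θ) ((hint (k + 2)).sub ((hint k).const_mul _))
  rw [intervalIntegral.integral_sub (hint (k + 2)) ((hint k).const_mul _),
    intervalIntegral.integral_const_mul] at hftc
  simp only [Real.cos_pi_div_two, Real.cos_zero, Real.sin_zero, zero_mul, one_pow, one_mul,
    gaussianMean_zero, ne_eq, Nat.add_eq_zero_iff, one_ne_zero, and_false, not_false_eq_true,
    zero_pow] at hftc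
  simp only [steinCoeff]
  linarith

end IsCbInfty

section TaylorInExpectation

variable {Ω : Type*} [MeasurableSpace Ω] {P : Measure Ω} {X : Ω → ℝ}

lemma integrable_pow_of_integrable_abs_pow (hX : AEMeasurable X P) {k : ℕ}
    (hk : Integrable (fun w => |X w| ^ k) P) : Integrable (fun w => X w ^ k) P :=
  hk.mono (hX.pow_const k).aestronglyMeasurable (ae_of_all _ fun w => by simp)

lemma IsCbInfty.abs_integral_sub_taylor_le {f : ℝ → ℝ} (hf : IsCbInfty f) [IsFiniteMeasure P]
    (hX : AEMeasurable X P) {n : ℕ} (hint : ∀ k ≤ n, Integrable (fun w => |X w| ^ k) P) :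
    |∫ w, f (X w) ∂P - ∑ k ∈ Finset.range n, iteratedDeriv k f 0 / k ! * ∫ w, X w ^ k ∂P|
      ≤ supNorm (iteratedDeriv n f) / n ! * ∫ w, |X w| ^ n ∂P := by
  have hterm : ∀ k ∈ Finset.range n,
      Integrable (fun w => iteratedDeriv k f 0 / k ! * X w ^ k) P := fun k hk =>
    (integrable_pow_of_integrable_abs_pow hX (hint k (Finset.mem_range.1 hk).le)).const_mul _
  simp_rw [← integral_const_mul]
  rw [← integral_finsetSum _ hterm,
    ← integral_sub (hf.integrable_comp hX) (integrable_finsetSum _ hterm)]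
  rw [← Real.norm_eq_abs]
  refine norm_integral_le_of_norm_le ((hint n le_rfl).const_mul _) (ae_of_all _ fun w => ?_)
  simpa using abs_sub_taylor_le (contDiff_infty.1 hf.1 n)
    (hf.iteratedDeriv n).abs_le 0 (X w)

lemma momentDiff_zero [IsProbabilityMeasure P] : momentDiff P X 0 = 0 := by simp [momentDiff]

lemma integral_abs_pow_eq_momentDiff_add {n : ℕ} (hn : Even n) :
    ∫ w, |X w| ^ n ∂P = momentDiff P X n + ∫ z, |z| ^ n ∂(gaussianReal 0 1) := by
  simp [momentDiff, hn.pow_abs]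

lemma IsCbInfty.abs_integral_sub_integral_gaussianReal_sub_taylor_le {f : ℝ → ℝ}
    (hf : IsCbInfty f) [IsFiniteMeasure P] (hX : AEMeasurable X P) {n : ℕ} (hn : Even n)
    (hint : ∀ k ≤ n, Integrable (fun w => |X w| ^ k) P) :
    |∫ w, f (X w) ∂P - ∫ z, f z ∂(gaussianReal 0 1)
        - ∑ k ∈ Finset.range n, iteratedDeriv k f 0 / k ! * momentDiff P X k|
      ≤ supNorm (iteratedDeriv n f) / n ! * |momentDiff P X n|
        + 2 * (supNorm (iteratedDeriv n f) / n ! * ∫ z, |z| ^ n ∂(gaussianReal 0 1)) := by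
  have hX_taylor := hf.abs_integral_sub_taylor_le hX hint
  have hZ_taylor := hf.abs_integral_sub_taylor_le (P := gaussianReal 0 1) (X := id) aemeasurable_id
    (n := n) fun k _ => integrable_abs_pow_gaussianReal k
  simp only [id] at hZ_taylor
  simp only [momentDiff, mul_sub, Finset.sum_sub_distrib]
  rw [sub_sub_sub_comm]
  calc _ ≤ _ := abs_sub _ _
    _ ≤ supNorm (iteratedDeriv n f) / n ! * ∫ w, |X w| ^ n ∂P
        + supNorm (iteratedDeriv n f) / n ! * ∫ z, |z| ^ n ∂(gaussianReal 0 1) := by gcongr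
    _ = supNorm (iteratedDeriv n f) / n ! * momentDiff P X n
        + 2 * (supNorm (iteratedDeriv n f) / n ! * ∫ z, |z| ^ n ∂(gaussianReal 0 1)) := by
      rw [integral_abs_pow_eq_momentDiff_add hn]; ring
    _ ≤ _ := by
      have := supNorm_nonneg (iteratedDeriv n f)
      gcongr
      exact le_abs_self _

end TaylorInExpectation

lemma sum_range_recurrence_div_factorial_mul (a ε : ℕ → ℝ) (n : ℕ) :
    ∑ k ∈ Finset.range (n + 1), (a (k + 2) - (k + 1) * a k) / (k + 1)! * ε (k + 1)
      = ∑ j ∈ Finset.range n, a (j + 1) / (j + 1)! * ((j + 1) * ε j - ε (j + 2))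
        + a (n + 1) / n ! * ε n + a (n + 2) / (n + 1)! * ε (n + 1) - (a 0 * ε 1 + a 1 * ε 0) := by
  induction n with
  | zero => simp; ring
  | succ n ih =>
    rw [Finset.sum_range_succ, ih, Finset.sum_range_succ, Nat.factorial_succ (n + 1),
      Nat.factorial_succ n]
    push_cast
    field_simp
    ring

/-- The bound `‖h'‖ |ε₁| + ∑ k ≥ 1, ‖h^(k+1)‖ / (k+1)! * |k ε_(k-1) - ε_(k+1)|` for
`|E h(X) - E h(Z)|` in terms of the moment differences `ε`. -/
noncomputable def momentBound (h : ℝ → ℝ) (ε : ℕ → ℝ) : ℝ :=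
  supNorm (iteratedDeriv 1 h) * |ε 1| + ∑' j : ℕ, boundTerm h ε (j + 1)

section MomentBound

variable {h g : ℝ → ℝ} {ε b : ℕ → ℝ}

lemma boundTerm_succ (h : ℝ → ℝ) (ε : ℕ → ℝ) (j : ℕ) :
    boundTerm h ε (j + 1)
      = supNorm (iteratedDeriv (j + 2) h) / (j + 2)! * |(j + 1) * ε j - ε (j + 2)| := by
  simp [boundTerm]

lemma boundTerm_nonneg (h : ℝ → ℝ) (ε : ℕ → ℝ) (k : ℕ) : 0 ≤ boundTerm h ε k :=
  mul_nonneg (div_nonneg (supNorm_nonneg _) (by positivity)) (abs_nonneg _)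

lemma boundTerm_mono (hgh : ∀ k, supNorm (iteratedDeriv k g) ≤ supNorm (iteratedDeriv k h))
    (ε : ℕ → ℝ) (k : ℕ) : boundTerm g ε k ≤ boundTerm h ε k := by
  unfold boundTerm
  gcongr
  exact hgh _

lemma momentBound_mono (hgh : ∀ k, supNorm (iteratedDeriv k g) ≤ supNorm (iteratedDeriv k h))
    (hsum : Summable fun j => boundTerm h ε (j + 1)) : momentBound g ε ≤ momentBound h ε := by
  have hterm (j : ℕ) := boundTerm_mono hgh ε (j + 1)
  refine add_le_add (by gcongr; exact hgh 1) ?_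
  exact (hsum.of_nonneg_of_le (fun _ => boundTerm_nonneg _ _ _) hterm).tsum_le_tsum hterm hsum

lemma IsCbInfty.abs_sum_taylor_le (hh : IsCbInfty h) (h0 : ε 0 = 0) (n : ℕ) :
    |∑ k ∈ Finset.range (n + 2), iteratedDeriv k h 0 / k ! * ε k|
      ≤ supNorm (iteratedDeriv 1 h) * |ε 1| + ∑ j ∈ Finset.range n, boundTerm h ε (j + 1)
        + supNorm (iteratedDeriv (n + 2) h) / n ! * |ε n|
        + supNorm (iteratedDeriv (n + 3) h) / (n + 1)! * |ε (n + 1)| := by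
  have hcoeff (k : ℕ) : |steinCoeff h k| ≤ supNorm (iteratedDeriv (k + 1) h) :=
    (hh.abs_steinCoeff_le k).trans
      (div_le_self (supNorm_nonneg _) (by exact_mod_cast Nat.le_add_left 1 k))
  have hterm (j : ℕ) : |steinCoeff h (j + 1) / (j + 1)! * ((j + 1) * ε j - ε (j + 2))|
      ≤ boundTerm h ε (j + 1) := by
    have hj := hh.abs_steinCoeff_le (j + 1)
    rw [boundTerm_succ, abs_mul, abs_div, Nat.abs_cast, Nat.factorial_succ (j + 1)]
    push_cast at hj ⊢
    rw [← div_div]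
    gcongr
  rw [Finset.sum_range_succ', h0, mul_zero, add_zero]
  simp_rw [← hh.steinCoeff_add_two_sub]
  rw [sum_range_recurrence_div_factorial_mul, h0, mul_zero, add_zero]
  calc _ ≤ _ := (abs_sub _ _).trans (add_le_add_left (abs_add_three _ _ _) _)
    _ ≤ ∑ j ∈ Finset.range n, boundTerm h ε (j + 1)
        + supNorm (iteratedDeriv (n + 2) h) / n ! * |ε n|
        + supNorm (iteratedDeriv (n + 3) h) / (n + 1)! * |ε (n + 1)|
        + supNorm (iteratedDeriv 1 h) * |ε 1| := by
      simp only [abs_mul (steinCoeff h _), abs_mul (steinCoeff h _ / _), abs_div, Nat.abs_cast]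
      gcongr
      · exact (Finset.abs_sum_le_sum_abs _ _).trans (Finset.sum_le_sum fun j _ => hterm j)
      all_goals exact hcoeff _
    _ = _ := by ring

lemma nonneg_of_supNorm_mul_le
    (hε : ∀ k, supNorm (iteratedDeriv k h) * |ε k| ≤ b k * k !) (k : ℕ) : 0 ≤ b k :=
  nonneg_of_mul_nonneg_left ((mul_nonneg (supNorm_nonneg _) (abs_nonneg _)).trans (hε k))
    (by positivity)

lemma boundTerm_succ_le
    (hε : ∀ k, supNorm (iteratedDeriv k h) * |ε k| ≤ b k * k !)
    (hε' : ∀ k, supNorm (iteratedDeriv (k + 2) h) * |ε k| ≤ b k * k !) (j : ℕ) :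
    boundTerm h ε (j + 1) ≤ b j + b (j + 2) := by
  have hfactor : (j + 1) * (j ! : ℝ) ≤ (j + 2)! := by
    exact_mod_cast Nat.factorial_le (Nat.le_succ (j + 1))
  have hM := supNorm_nonneg (iteratedDeriv (j + 2) h)
  have hb := nonneg_of_supNorm_mul_le hε j
  rw [boundTerm_succ, div_mul_eq_mul_div, div_le_iff₀ (by positivity)]
  calc _ ≤ supNorm (iteratedDeriv (j + 2) h) * (|(j + 1) * ε j| + |ε (j + 2)|) := by
        gcongr
        exact abs_sub _ _
    _ = (j + 1) * (supNorm (iteratedDeriv (j + 2) h) * |ε j|)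
        + supNorm (iteratedDeriv (j + 2) h) * |ε (j + 2)| := by
      rw [abs_mul, abs_of_nonneg (by positivity)]; ring
    _ ≤ (j + 1) * (b j * j !) + b (j + 2) * (j + 2)! :=
      add_le_add (mul_le_mul_of_nonneg_left (hε' j) (by positivity)) (hε (j + 2))
    _ = b j * ((j + 1) * j !) + b (j + 2) * (j + 2)! := by ring
    _ ≤ (b j + b (j + 2)) * (j + 2)! := by
      rw [add_mul (b j)]
      gcongr

lemma summable_boundTerm_succ (hb : Summable b)
    (hε : ∀ k, supNorm (iteratedDeriv k h) * |ε k| ≤ b k * k !)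
    (hε' : ∀ k, supNorm (iteratedDeriv (k + 2) h) * |ε k| ≤ b k * k !) :
    Summable fun j => boundTerm h ε (j + 1) :=
  (hb.add ((summable_nat_add_iff 2).2 hb)).of_nonneg_of_le (fun _ => boundTerm_nonneg _ _ _)
    (boundTerm_succ_le hε hε')

lemma momentBound_le (hb : Summable b)
    (hε : ∀ k, supNorm (iteratedDeriv k h) * |ε k| ≤ b k * k !)
    (hε' : ∀ k, supNorm (iteratedDeriv (k + 2) h) * |ε k| ≤ b k * k !) :
    momentBound h ε ≤ 2 * ∑' k, b k := by
  have hb2 := (summable_nat_add_iff 2).2 hb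
  have hone : supNorm (iteratedDeriv 1 h) * |ε 1| ≤ b 1 := by simpa using hε 1
  have htail : ∑' j, boundTerm h ε (j + 1) ≤ ∑' j, b j + ∑' j, b (j + 2) := by
    rw [← hb.tsum_add hb2]
    exact (summable_boundTerm_succ hb hε hε').tsum_le_tsum (boundTerm_succ_le hε hε') (hb.add hb2)
  have hhead := hb.sum_add_tsum_nat_add 2
  rw [Finset.sum_range_succ, Finset.sum_range_one] at hhead
  have := nonneg_of_supNorm_mul_le hε 0
  unfold momentBound
  linarith

end MomentBound

section GeometricGrowth

variable {g : ℝ → ℝ} {Ω : Type*} [MeasurableSpace Ω] {P : Measure Ω} [IsProbabilityMeasure P]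
  {X : Ω → ℝ} {b : ℕ → ℝ}

lemma IsCbInfty.abs_integral_sub_le_momentBound_add (hg : IsCbInfty g) (hX : AEMeasurable X P)
    (hint : ∀ k, Integrable (fun w => |X w| ^ k) P) (hb : Summable b)
    (hε : ∀ k, supNorm (iteratedDeriv k g) * |momentDiff P X k| ≤ b k * k !)
    (hε' : ∀ k, supNorm (iteratedDeriv (k + 2) g) * |momentDiff P X k| ≤ b k * k !) {n : ℕ}
    (hn : Even n) :
    |∫ w, g (X w) ∂P - ∫ z, g z ∂(gaussianReal 0 1)|
      ≤ momentBound g (momentDiff P X) + (b n + b (n + 1) + (b (n + 2) + 2 *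
        (supNorm (iteratedDeriv (n + 2) g) * (∫ z, |z| ^ (n + 2) ∂(gaussianReal 0 1))
          / (n + 2)!))) := by
  have hdiv {k : ℕ} {c : ℝ} (hc : c ≤ b k * k !) : c / k ! ≤ b k :=
    (div_le_iff₀ (by positivity)).2 hc
  have htaylor := hg.abs_integral_sub_integral_gaussianReal_sub_taylor_le hX
    (hn.add even_two) fun k _ => hint k
  have hsum := hg.abs_sum_taylor_le (momentDiff_zero (P := P) (X := X)) n
  have hpartial := (summable_boundTerm_succ hb hε hε').sum_le_tsum (Finset.range n)
    fun j _ => boundTerm_nonneg _ _ _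
  have hn0 := hdiv (hε' n)
  have hn1 := hdiv (hε' (n + 1))
  have hn2 := hdiv (hε (n + 2))
  have htriangle := abs_sub_abs_le_abs_sub (∫ w, g (X w) ∂P - ∫ z, g z ∂(gaussianReal 0 1))
    (∑ k ∈ Finset.range (n + 2), iteratedDeriv k g 0 / k ! * momentDiff P X k)
  simp only [div_mul_eq_mul_div] at htaylor hsum htriangle
  unfold momentBound
  linarith

lemma IsCbInfty.abs_integral_sub_le_momentBound_of_tendsto (hg : IsCbInfty g)
    (hlim : Tendsto (fun k : ℕ => supNorm (iteratedDeriv k g)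
      * (∫ z, |z| ^ k ∂(gaussianReal 0 1)) / k !) atTop (nhds 0))
    (hX : AEMeasurable X P) (hint : ∀ k, Integrable (fun w => |X w| ^ k) P) (hb : Summable b)
    (hε : ∀ k, supNorm (iteratedDeriv k g) * |momentDiff P X k| ≤ b k * k !)
    (hε' : ∀ k, supNorm (iteratedDeriv (k + 2) g) * |momentDiff P X k| ≤ b k * k !) :
    |∫ w, g (X w) ∂P - ∫ z, g z ∂(gaussianReal 0 1)| ≤ momentBound g (momentDiff P X) := by
  have hb0 (i : ℕ) := hb.tendsto_atTop_zero.comp (tendsto_add_atTop_nat i)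
  have herror := ((hb0 0).add (hb0 1)).add
    ((hb0 2).add ((hlim.comp (tendsto_add_atTop_nat 2)).const_mul 2))
  have heven : Tendsto (fun m : ℕ => 2 * m) atTop atTop := tendsto_id.const_mul_atTop' two_pos
  refine ge_of_tendsto (x := atTop) ?_ (Eventually.of_forall fun m =>
    hg.abs_integral_sub_le_momentBound_add hX hint hb hε hε' (even_two_mul m))
  simpa [Function.comp_def] using (herror.comp heven).const_add (momentBound g (momentDiff P X))

end GeometricGrowth

section Sinc

/-- The `k`-th derivative of `Real.sinc`, obtained by differentiating `∫ t in 0..1, cos (t * x)`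
under the integral sign. -/
noncomputable def sincDeriv (k : ℕ) (x : ℝ) : ℝ :=
  ∫ t in (0 : ℝ)..1, t ^ k * Real.cos (t * x + k * (Real.pi / 2))

lemma hasDerivAt_cos_mul_add_pi_div_two (k : ℕ) (c y : ℝ) :
    HasDerivAt (fun y => Real.cos (c * y + k * (Real.pi / 2)))
      (c * Real.cos (c * y + (k + 1 : ℕ) * (Real.pi / 2))) y := by
  convert! (((hasDerivAt_const_mul c).add_const (k * (Real.pi / 2))).cos) using 1
  rw [Nat.cast_succ, add_one_mul, ← add_assoc, Real.cos_add_pi_div_two]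
  ring

lemma abs_pow_mul_cos_le {t : ℝ} (ht : t ∈ Set.uIoc (0 : ℝ) 1) (k : ℕ) (y : ℝ) :
    |t ^ k * Real.cos y| ≤ t ^ k := by
  rw [Set.uIoc_of_le zero_le_one] at ht
  rw [abs_mul, abs_of_nonneg (pow_nonneg ht.1.le k)]
  exact mul_le_of_le_one_right (pow_nonneg ht.1.le k) (Real.abs_cos_le_one y)

lemma hasDerivAt_sincDeriv (k : ℕ) (x : ℝ) :
    HasDerivAt (sincDeriv k) (sincDeriv (k + 1) x) x := by
  refine (intervalIntegral.hasDerivAt_integral_of_dominated_loc_of_deriv_le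
    (F := fun x t => t ^ k * Real.cos (t * x + k * (Real.pi / 2)))
    (F' := fun x t => t ^ (k + 1) * Real.cos (t * x + (k + 1 : ℕ) * (Real.pi / 2)))
    (bound := fun t => t ^ (k + 1)) (s := Set.univ) univ_mem
    (Eventually.of_forall fun x => Continuous.aestronglyMeasurable (by fun_prop))
    (Continuous.intervalIntegrable (by fun_prop) _ _)
    (Continuous.aestronglyMeasurable (by fun_prop))
    (ae_of_all _ fun t ht x _ => abs_pow_mul_cos_le ht _ _)
    (Continuous.intervalIntegrable (by fun_prop) _ _)
    (ae_of_all _ fun t _ x _ => ?_)).2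
  convert! (hasDerivAt_cos_mul_add_pi_div_two k t x).const_mul (t ^ k) using 1
  ring

lemma abs_sincDeriv_le (k : ℕ) (x : ℝ) : |sincDeriv k x| ≤ 1 / (k + 1) := by
  have hpow : ∫ t in (0 : ℝ)..1, t ^ k = 1 / (k + 1) := by simp
  rw [sincDeriv, ← hpow, ← Real.norm_eq_abs]
  refine intervalIntegral.norm_integral_le_of_norm_le zero_le_one (ae_of_all _ fun t ht => ?_)
    (Continuous.intervalIntegrable (by fun_prop) _ _)
  exact abs_pow_mul_cos_le (by rwa [Set.uIoc_of_le zero_le_one]) k _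

lemma succ_mul_sincDeriv_add (k : ℕ) (x : ℝ) :
    (k + 1) * sincDeriv k x + x * sincDeriv (k + 1) x = Real.cos (x + k * (Real.pi / 2)) := by
  have hderiv (t : ℝ) : HasDerivAt (fun t => t ^ (k + 1) * Real.cos (t * x + k * (Real.pi / 2)))
      ((k + 1) * (t ^ k * Real.cos (t * x + k * (Real.pi / 2)))
        + x * (t ^ (k + 1) * Real.cos (t * x + (k + 1 : ℕ) * (Real.pi / 2)))) t := by
    simp only [mul_comm _ x]
    convert! (hasDerivAt_pow (k + 1) t).mul (hasDerivAt_cos_mul_add_pi_div_two k x t) using 1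
    push_cast
    ring
  have hint (j : ℕ) : IntervalIntegrable
      (fun t => t ^ j * Real.cos (t * x + j * (Real.pi / 2))) volume 0 1 :=
    Continuous.intervalIntegrable (by fun_prop) _ _
  have hftc := intervalIntegral.integral_eq_sub_of_hasDerivAt (a := 0) (b := 1)
    (fun t _ => hderiv t) (((hint k).const_mul _).add ((hint (k + 1)).const_mul _))
  rw [intervalIntegral.integral_add ((hint k).const_mul _) ((hint (k + 1)).const_mul _),
    intervalIntegral.integral_const_mul, intervalIntegral.integral_const_mul] at hftc
  simpa [sincDeriv] using hftc

lemma mul_sincDeriv_zero (x : ℝ) : x * sincDeriv 0 x = Real.sin x := by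
  simp [sincDeriv]

lemma sincDeriv_zero : sincDeriv 0 = Real.sinc := by
  ext x
  rcases eq_or_ne x 0 with rfl | hx
  · simp [sincDeriv]
  · rw [Real.sinc_of_ne_zero hx, ← mul_sincDeriv_zero, mul_div_cancel_left₀ _ hx]

lemma contDiff_sinc : ContDiff ℝ ∞ Real.sinc :=
  sincDeriv_zero ▸ contDiff_infty_of_hasDerivAt_succ hasDerivAt_sincDeriv

lemma iteratedDeriv_sinc (k : ℕ) : iteratedDeriv k Real.sinc = sincDeriv k :=
  sincDeriv_zero ▸ iteratedDeriv_eq_of_hasDerivAt_succ hasDerivAt_sincDeriv k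

lemma abs_mul_sincDeriv_le (k : ℕ) (x : ℝ) : |x * sincDeriv k x| ≤ 2 := by
  cases k with
  | zero =>
    rw [mul_sincDeriv_zero]
    exact (Real.abs_sin_le_one x).trans one_le_two
  | succ k =>
    have hbound : |((k : ℝ) + 1) * sincDeriv k x| ≤ 1 := by
      rw [abs_mul, abs_of_nonneg (by positivity)]
      exact (le_div_iff₀' (by positivity)).1 (abs_sincDeriv_le k x)
    rw [← sub_eq_of_eq_add' (succ_mul_sincDeriv_add k x).symm]
    linarith [abs_sub (Real.cos (x + k * (Real.pi / 2))) ((k + 1) * sincDeriv k x),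
      Real.abs_cos_le_one (x + k * (Real.pi / 2))]

lemma sincDeriv_sq_le (k : ℕ) (x : ℝ) : sincDeriv k x ^ 2 ≤ 5 * (1 + x ^ 2)⁻¹ := by
  have hone : sincDeriv k x ^ 2 ≤ 1 := (sq_le_one_iff_abs_le_one _).2
    ((abs_sincDeriv_le k x).trans (div_le_one_of_le₀ (by simp) (by positivity)))
  have hfour := sq_le_sq' (abs_le.1 (abs_mul_sincDeriv_le k x)).1
    (abs_le.1 (abs_mul_sincDeriv_le k x)).2
  rw [← div_eq_mul_inv, le_div_iff₀ (by positivity)]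
  linarith [mul_pow x (sincDeriv k x) 2]

lemma abs_sincDeriv_mul_le (i j : ℕ) (x : ℝ) :
    |sincDeriv i x * sincDeriv j x| ≤ 5 * (1 + x ^ 2)⁻¹ := by
  have := two_mul_le_add_sq |sincDeriv i x| |sincDeriv j x|
  rw [sq_abs, sq_abs] at this
  rw [abs_mul]
  linarith [sincDeriv_sq_le i x, sincDeriv_sq_le j x]

lemma abs_iteratedDeriv_sinc_sq_le (k : ℕ) (x : ℝ) :
    |iteratedDeriv k (fun x => Real.sinc x ^ 2) x| ≤ 2 ^ k * (5 * (1 + x ^ 2)⁻¹) := by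
  have hsmooth : ContDiffAt ℝ k Real.sinc x := (contDiff_infty.1 contDiff_sinc k).contDiffAt
  simp only [sq (Real.sinc _)]
  rw [iteratedDeriv_fun_mul hsmooth hsmooth]
  simp only [iteratedDeriv_sinc, mul_assoc]
  calc _ ≤ ∑ i ∈ Finset.range (k + 1), |k.choose i * (sincDeriv i x * sincDeriv (k - i) x)| :=
        Finset.abs_sum_le_sum_abs _ _
    _ ≤ ∑ i ∈ Finset.range (k + 1), (k.choose i : ℝ) * (5 * (1 + x ^ 2)⁻¹) := by
      gcongr with i
      rw [abs_mul, Nat.abs_cast]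
      gcongr
      exact abs_sincDeriv_mul_le i (k - i) x
    _ = 2 ^ k * (5 * (1 + x ^ 2)⁻¹) := by
      rw [← Finset.sum_mul, ← Nat.cast_sum, Nat.sum_range_choose, Nat.cast_pow, Nat.cast_ofNat]

end Sinc

section FejerKernel

lemma continuous_sinc_sq : Continuous fun x => Real.sinc x ^ 2 := Real.continuous_sinc.pow 2

lemma integrable_sinc_sq : Integrable fun x => Real.sinc x ^ 2 :=
  (integrable_inv_one_add_sq.const_mul 5).mono' continuous_sinc_sq.aestronglyMeasurable
    (ae_of_all _ fun x => by simpa using abs_iteratedDeriv_sinc_sq_le 0 x)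

lemma integral_sinc_sq_pos : 0 < ∫ x, Real.sinc x ^ 2 :=
  integral_pos_of_integrable_nonneg_nonzero (x := 0) continuous_sinc_sq integrable_sinc_sq
    (fun _ => sq_nonneg _) (by simp)

/-- The Fejér kernel, normalised to have integral one. It is nonnegative and its Fourier transform
has compact support, so that its derivatives grow at most geometrically in `L¹`. -/
noncomputable def fejerKernel (x : ℝ) : ℝ := (∫ y, Real.sinc y ^ 2)⁻¹ * Real.sinc x ^ 2

lemma fejerKernel_nonneg (x : ℝ) : 0 ≤ fejerKernel x :=
  mul_nonneg (inv_nonneg.2 integral_sinc_sq_pos.le) (sq_nonneg _)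

lemma integral_fejerKernel : ∫ x, fejerKernel x = 1 := by
  simp only [fejerKernel, integral_const_mul]
  exact inv_mul_cancel₀ integral_sinc_sq_pos.ne'

lemma contDiff_fejerKernel : ContDiff ℝ ∞ fejerKernel := contDiff_const.mul (contDiff_sinc.pow 2)

lemma abs_iteratedDeriv_fejerKernel_le (k : ℕ) (x : ℝ) :
    |iteratedDeriv k fejerKernel x|
      ≤ (∫ y, Real.sinc y ^ 2)⁻¹ * (2 ^ k * (5 * (1 + x ^ 2)⁻¹)) := by
  have hpos := inv_pos.2 integral_sinc_sq_pos
  unfold fejerKernel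
  rw [iteratedDeriv_const_mul_field, abs_mul, abs_of_pos hpos]
  gcongr
  exact abs_iteratedDeriv_sinc_sq_le k x

lemma integrable_iteratedDeriv_fejerKernel (k : ℕ) : Integrable (iteratedDeriv k fejerKernel) :=
  (((integrable_inv_one_add_sq.const_mul 5).const_mul (2 ^ k)).const_mul _).mono'
    (contDiff_fejerKernel.continuous_iteratedDeriv k
      (by exact_mod_cast le_top)).aestronglyMeasurable
    (ae_of_all _ (abs_iteratedDeriv_fejerKernel_le k))

lemma integral_abs_iteratedDeriv_fejerKernel_le (k : ℕ) :
    ∫ x, |iteratedDeriv k fejerKernel x| ≤ (∫ y, Real.sinc y ^ 2)⁻¹ * (5 * Real.pi) * 2 ^ k :=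
  calc _ ≤ ∫ x, (∫ y, Real.sinc y ^ 2)⁻¹ * (2 ^ k * (5 * (1 + x ^ 2)⁻¹)) :=
        integral_mono (integrable_iteratedDeriv_fejerKernel k).abs
          (((integrable_inv_one_add_sq.const_mul 5).const_mul (2 ^ k)).const_mul _)
          (abs_iteratedDeriv_fejerKernel_le k)
    _ = _ := by
      simp only [integral_const_mul, integral_univ_inv_one_add_sq]
      ring

end FejerKernel

/-- The average of `f` against the kernel `ψ` at scale `σ`: the convolution of `f` with the
reflection of `σ⁻¹ ψ(σ⁻¹ ·)`, written so that it also makes sense for `σ = 0`. -/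
noncomputable def kernelMean (ψ f : ℝ → ℝ) (σ x : ℝ) : ℝ := ∫ y, f (x + σ * y) * ψ y

namespace IsCbInfty

variable {ψ f : ℝ → ℝ}

lemma norm_mul_kernel_le (hf : IsCbInfty f) (x y : ℝ) : ‖f x * ψ y‖ ≤ supNorm f * |ψ y| := by
  rw [Real.norm_eq_abs, abs_mul]
  gcongr
  exact hf.abs_le _

lemma integrable_mul_kernel (hf : IsCbInfty f) (hψ : Integrable ψ) (σ x : ℝ) :
    Integrable fun y => f (x + σ * y) * ψ y :=
  (hψ.abs.const_mul _).mono' ((hf.continuous.comp (by fun_prop)).aestronglyMeasurable.mul hψ.1)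
    (ae_of_all _ fun _ => hf.norm_mul_kernel_le _ _)

lemma abs_kernelMean_le (hf : IsCbInfty f) (hψ : Integrable ψ) (σ x : ℝ) :
    |kernelMean ψ f σ x| ≤ supNorm f * ∫ y, |ψ y| := by
  rw [← integral_const_mul]
  exact norm_integral_le_of_norm_le (hψ.abs.const_mul _)
    (ae_of_all _ fun _ => hf.norm_mul_kernel_le _ _)

lemma hasDerivAt_kernelMean (hf : IsCbInfty f) (hψ : Integrable ψ) (σ x : ℝ) :
    HasDerivAt (kernelMean ψ f σ) (kernelMean ψ (deriv f) σ x) x :=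
  (hasDerivAt_integral_of_dominated_loc_of_deriv_le
    (F' := fun x y => deriv f (x + σ * y) * ψ y) univ_mem
    (Eventually.of_forall fun x => (hf.integrable_mul_kernel hψ σ x).aestronglyMeasurable)
    (hf.integrable_mul_kernel hψ σ x)
    (hf.deriv.integrable_mul_kernel hψ σ x).aestronglyMeasurable
    (ae_of_all _ fun _ _ _ => hf.deriv.norm_mul_kernel_le _ _)
    (hψ.abs.const_mul _)
    (ae_of_all _ fun y x _ => (hf.hasDerivAt (x + σ * y)).comp_add_const x (σ * y)
      |>.mul_const _)).2

lemma hasDerivAt_kernelMean_iteratedDeriv (hf : IsCbInfty f) (hψ : Integrable ψ) (σ : ℝ) (k : ℕ)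
    (x : ℝ) : HasDerivAt (kernelMean ψ (iteratedDeriv k f) σ)
      (kernelMean ψ (iteratedDeriv (k + 1) f) σ x) x :=
  iteratedDeriv_succ (f := f) ▸ (hf.iteratedDeriv k).hasDerivAt_kernelMean hψ σ x

lemma iteratedDeriv_kernelMean (hf : IsCbInfty f) (hψ : Integrable ψ) (σ : ℝ) (k : ℕ) :
    iteratedDeriv k (kernelMean ψ f σ) = kernelMean ψ (iteratedDeriv k f) σ := by
  simpa using iteratedDeriv_eq_of_hasDerivAt_succ (hf.hasDerivAt_kernelMean_iteratedDeriv hψ σ) k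

protected lemma kernelMean (hf : IsCbInfty f) (hψ : Integrable ψ) (σ : ℝ) :
    IsCbInfty (kernelMean ψ f σ) := by
  refine ⟨?_, fun k => ⟨supNorm (iteratedDeriv k f) * ∫ y, |ψ y|, fun x => ?_⟩⟩
  · simpa using contDiff_infty_of_hasDerivAt_succ (hf.hasDerivAt_kernelMean_iteratedDeriv hψ σ)
  · rw [hf.iteratedDeriv_kernelMean hψ]
    exact (hf.iteratedDeriv k).abs_kernelMean_le hψ σ x

lemma mul_kernelMean_deriv (hf : IsCbInfty f) (hdiff : Differentiable ℝ ψ) (hψ : Integrable ψ)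
    (hψ' : Integrable (deriv ψ)) (σ x : ℝ) :
    σ * kernelMean ψ (deriv f) σ x = -kernelMean (deriv ψ) f σ x := by
  have hscale (y : ℝ) : HasDerivAt (fun y => f (x + σ * y)) (σ * deriv f (x + σ * y)) y := by
    simpa [mul_comm, Function.comp_def] using
      (hf.hasDerivAt (x + σ * y)).comp y ((hasDerivAt_const_mul σ).const_add x)
  have hparts := integral_mul_deriv_eq_deriv_mul_of_integrable (v := ψ) (v' := deriv ψ)
    (fun y _ => hscale y) (fun y _ => (hdiff y).hasDerivAt) (hf.integrable_mul_kernel hψ' σ x)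
    (((hf.deriv.integrable_mul_kernel hψ σ x).const_mul σ).congr
      (ae_of_all _ fun y => (mul_assoc _ _ _).symm))
    (hf.integrable_mul_kernel hψ σ x)
  simp only [mul_assoc, integral_const_mul] at hparts
  exact (neg_eq_iff_eq_neg.2 hparts).symm

lemma pow_mul_kernelMean_iteratedDeriv (hψ : ContDiff ℝ ∞ ψ)
    (hint : ∀ k, Integrable (iteratedDeriv k ψ)) (σ x : ℝ) (k : ℕ) :
    ∀ {f : ℝ → ℝ}, IsCbInfty f → σ ^ k * kernelMean ψ (iteratedDeriv k f) σ x
      = (-1) ^ k * kernelMean (iteratedDeriv k ψ) f σ x := by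
  induction k with
  | zero => simp
  | succ k ih =>
    intro f hf
    have hstep := hf.mul_kernelMean_deriv
      (hψ.differentiable_iteratedDeriv k (by exact_mod_cast ENat.natCast_lt_top k)) (hint k)
      (iteratedDeriv_succ (f := ψ) ▸ hint (k + 1)) σ x
    rw [iteratedDeriv_succ', iteratedDeriv_succ, pow_succ', mul_assoc, ih hf.deriv,
      mul_left_comm, hstep, pow_succ]
    ring

lemma continuous_kernelMean_scale (hf : IsCbInfty f) (hψ : Integrable ψ) (x : ℝ) :
    Continuous fun σ => kernelMean ψ f σ x :=
  continuous_of_dominated (fun σ => (hf.integrable_mul_kernel hψ σ x).aestronglyMeasurable)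
    (fun _ => ae_of_all _ fun _ => hf.norm_mul_kernel_le _ _) (hψ.abs.const_mul _)
    (ae_of_all _ fun _ => (hf.continuous.comp (by fun_prop)).mul continuous_const)

lemma continuous_integral_kernelMean_scale (hf : IsCbInfty f) (hψ : Integrable ψ) {Ω : Type*}
    [MeasurableSpace Ω] {P : Measure Ω} [IsFiniteMeasure P] {X : Ω → ℝ} (hX : AEMeasurable X P) :
    Continuous fun σ => ∫ w, kernelMean ψ f σ (X w) ∂P :=
  continuous_of_dominated
    (fun σ => ((hf.kernelMean hψ σ).integrable_comp hX).aestronglyMeasurable)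
    (fun _ => ae_of_all _ fun _ => hf.abs_kernelMean_le hψ _ _) (integrable_const _)
    (ae_of_all _ fun _ => hf.continuous_kernelMean_scale hψ _)

end IsCbInfty

section FejerMean

variable {f : ℝ → ℝ}

lemma integrable_fejerKernel : Integrable fejerKernel := by
  simpa using integrable_iteratedDeriv_fejerKernel 0

lemma kernelMean_fejerKernel_zero (f : ℝ → ℝ) (x : ℝ) : kernelMean fejerKernel f 0 x = f x := by
  simp [kernelMean, integral_const_mul, integral_fejerKernel]

lemma IsCbInfty.supNorm_iteratedDeriv_kernelMean_fejerKernel_le (hf : IsCbInfty f) (σ : ℝ)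
    (k : ℕ) :
    supNorm (iteratedDeriv k (kernelMean fejerKernel f σ)) ≤ supNorm (iteratedDeriv k f) := by
  refine supNorm_le fun x => ?_
  have hbound := (hf.iteratedDeriv k).abs_kernelMean_le integrable_fejerKernel σ x
  simp only [abs_of_nonneg (fejerKernel_nonneg _), integral_fejerKernel, mul_one] at hbound
  rwa [hf.iteratedDeriv_kernelMean integrable_fejerKernel]

lemma IsCbInfty.supNorm_iteratedDeriv_kernelMean_fejerKernel_le_geometric (hf : IsCbInfty f)
    {σ : ℝ} (hσ : 0 < σ) (k : ℕ) :
    supNorm (iteratedDeriv k (kernelMean fejerKernel f σ))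
      ≤ supNorm f * ((∫ y, Real.sinc y ^ 2)⁻¹ * (5 * Real.pi)) * (2 / σ) ^ k := by
  refine supNorm_le fun x => ?_
  have hparts := congrArg abs (pow_mul_kernelMean_iteratedDeriv contDiff_fejerKernel
    integrable_iteratedDeriv_fejerKernel σ x k hf)
  rw [abs_mul, abs_mul, abs_neg_one_pow, one_mul, abs_of_pos (pow_pos hσ k)] at hparts
  rw [hf.iteratedDeriv_kernelMean integrable_fejerKernel, div_pow, ← mul_div_assoc,
    le_div_iff₀' (pow_pos hσ k), hparts, mul_assoc]
  exact (hf.abs_kernelMean_le (integrable_iteratedDeriv_fejerKernel k) σ x).trans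
    (mul_le_mul_of_nonneg_left (integral_abs_iteratedDeriv_fejerKernel_le k) (supNorm_nonneg f))

lemma IsCbInfty.tendsto_supNorm_iteratedDeriv_kernelMean_fejerKernel (hf : IsCbInfty f) {σ : ℝ}
    (hσ : 0 < σ) :
    Tendsto (fun k : ℕ => supNorm (iteratedDeriv k (kernelMean fejerKernel f σ))
      * (∫ z, |z| ^ k ∂(gaussianReal 0 1)) / k !) atTop (nhds 0) := by
  have hexp := tendsto_pow_mul_integral_abs_pow_div_factorial (X := id) aemeasurable_id
    (by positivity : 0 ≤ 2 / σ) (integrable_exp_mul_abs_gaussianReal (2 / σ))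
  have hmajorant :=
    hexp.const_mul (supNorm f * ((∫ y, Real.sinc y ^ 2)⁻¹ * (5 * Real.pi)))
  rw [mul_zero] at hmajorant
  refine squeeze_zero (fun k => ?_) (fun k => ?_) hmajorant
  · have := supNorm_nonneg (iteratedDeriv k (kernelMean fejerKernel f σ))
    positivity
  · rw [← mul_div_assoc, ← mul_assoc]
    exact div_le_div_of_nonneg_right (mul_le_mul_of_nonneg_right
      (hf.supNorm_iteratedDeriv_kernelMean_fejerKernel_le_geometric hσ k)
      (integral_nonneg fun _ => by positivity)) (by positivity)

end FejerMean

section MainEstimate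

variable {h : ℝ → ℝ} {Ω : Type*} [MeasurableSpace Ω] {P : Measure Ω} [IsProbabilityMeasure P]
  {X : Ω → ℝ} {b : ℕ → ℝ}

lemma IsCbInfty.abs_integral_sub_le_momentBound (hh : IsCbInfty h) (hX : AEMeasurable X P)
    (hint : ∀ k, Integrable (fun w => |X w| ^ k) P) (hb : Summable b)
    (hε : ∀ k, supNorm (iteratedDeriv k h) * |momentDiff P X k| ≤ b k * k !)
    (hε' : ∀ k, supNorm (iteratedDeriv (k + 2) h) * |momentDiff P X k| ≤ b k * k !) :
    |∫ w, h (X w) ∂P - ∫ z, h z ∂(gaussianReal 0 1)| ≤ momentBound h (momentDiff P X) := by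
  have hmono (σ : ℝ) (k : ℕ) := hh.supNorm_iteratedDeriv_kernelMean_fejerKernel_le σ k
  have hsmooth {σ : ℝ} (hσ : 0 < σ) :
      |∫ w, kernelMean fejerKernel h σ (X w) ∂P
          - ∫ z, kernelMean fejerKernel h σ z ∂(gaussianReal 0 1)|
        ≤ momentBound h (momentDiff P X) :=
    ((hh.kernelMean integrable_fejerKernel σ).abs_integral_sub_le_momentBound_of_tendsto
      (hh.tendsto_supNorm_iteratedDeriv_kernelMean_fejerKernel hσ) hX hint hb
      (fun k => (mul_le_mul_of_nonneg_right (hmono σ k) (abs_nonneg _)).trans (hε k))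
      (fun k => (mul_le_mul_of_nonneg_right (hmono σ (k + 2)) (abs_nonneg _)).trans (hε' k))).trans
      (momentBound_mono (hmono σ) (summable_boundTerm_succ hb hε hε'))
  have hcont := ((hh.continuous_integral_kernelMean_scale integrable_fejerKernel hX).sub
    (hh.continuous_integral_kernelMean_scale (P := gaussianReal 0 1) integrable_fejerKernel
      aemeasurable_id)).abs
  have hlim := (hcont.tendsto 0).mono_left (nhdsWithin_le_nhds (s := Set.Ioi 0))
  simp only [Pi.sub_apply, kernelMean_fejerKernel_zero, id] at hlim
  exact le_of_tendsto hlim (eventually_mem_nhdsWithin.mono fun σ (hσ : 0 < σ) => hsmooth hσ)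

lemma le_div_mul_factorial {a b : ℕ → ℝ} (h0 : a 0 = 0)
    (ha : ∀ k : ℕ, 1 ≤ k → a k ≤ b k * (k - 1)!) (k : ℕ) : a k ≤ b k / k * k ! := by
  cases k with
  | zero => simp [h0]
  | succ k =>
    refine (ha (k + 1) k.succ_pos).trans_eq ?_
    rw [Nat.factorial_succ, Nat.add_sub_cancel, Nat.cast_mul, ← mul_assoc,
      div_mul_cancel₀ _ (by positivity)]

lemma summable_rpow_neg_div {δ : ℝ} (hδ : 0 < δ) : Summable fun k : ℕ => (k : ℝ) ^ (-δ) / k := by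
  refine (Real.summable_nat_rpow.2 (by linarith : -δ - 1 < -1)).congr fun k => ?_
  rcases k.eq_zero_or_pos with rfl | hk
  · simp [Real.zero_rpow (by linarith : -δ - 1 ≠ 0)]
  · exact Real.rpow_sub_one (Nat.cast_ne_zero.2 hk.ne') _

theorem mainTheorem5_general (hh : IsCbInfty h) (hX : AEMeasurable X P)
    (hint : ∀ k, Integrable (fun w => |X w| ^ k) P) (hb : Summable fun k => b k / k)
    (hε : ∀ k, 1 ≤ k →
      supNorm (iteratedDeriv k h) * |momentDiff P X k| ≤ b k * (k - 1)! ∧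
      supNorm (iteratedDeriv (k + 2) h) * |momentDiff P X k| ≤ b k * (k - 1)!) :
    Summable (fun j => boundTerm h (momentDiff P X) (j + 1)) ∧
      |∫ w, h (X w) ∂P - ∫ z, h z ∂(gaussianReal 0 1)| ≤ momentBound h (momentDiff P X) ∧
      momentBound h (momentDiff P X) ≤ 2 * ∑' k, b k / k := by
  have hzero (j : ℕ) : supNorm (iteratedDeriv j h) * |momentDiff P X 0| = 0 := by
    rw [momentDiff_zero, abs_zero, mul_zero]
  have hlow := le_div_mul_factorial (hzero 0) fun k hk => (hε k hk).1
  have hhigh := le_div_mul_factorial (hzero (0 + 2)) fun k hk => (hε k hk).2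
  exact ⟨summable_boundTerm_succ hb hlow hhigh,
    hh.abs_integral_sub_le_momentBound hX hint hb hlow hhigh, momentBound_le hb hlow hhigh⟩

end MainEstimate

theorem mainTheorem5 (h : ℝ → ℝ) (hh : IsCbInfty h) (δ C : ℝ) (hδ : 0 < δ) (hC : 0 < C) :
    ∃ K : ℝ, ∀ (α : ℝ), 0 < α →
      ∀ (Ω : ℕ → Type*) [∀ n, MeasurableSpace (Ω n)] (P : ∀ n, Measure (Ω n))
        [∀ n, IsProbabilityMeasure (P n)] (X : ∀ n, Ω n → ℝ),
        (∀ n, 1 ≤ n → AEMeasurable (X n) (P n)) →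
        (∀ n, 1 ≤ n → ∀ k : ℕ, Integrable (fun w => |X n w| ^ k) (P n)) →
        (∀ n, 1 ≤ n →
          (fun k : ℕ => ∫ w, |X n w| ^ k ∂(P n)) =o[atTop] (fun k : ℕ => (k ! : ℝ))) →
        (∀ n, 1 ≤ n → ∀ k : ℕ, 1 ≤ k →
          supNorm (iteratedDeriv k h) * |momentDiff (P n) (X n) k|
              ≤ C / (n : ℝ) ^ α * (k : ℝ) ^ (-δ) * ((k - 1)! : ℝ) ∧
          supNorm (iteratedDeriv (k + 2) h) * |momentDiff (P n) (X n) k|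
              ≤ C / (n : ℝ) ^ α * (k : ℝ) ^ (-δ) * ((k - 1)! : ℝ)) →
        ∀ n, 1 ≤ n →
          Summable (fun j : ℕ => boundTerm h (momentDiff (P n) (X n)) (j + 1)) ∧
          |(∫ w, h (X n w) ∂(P n)) - ∫ z, h z ∂(gaussianReal 0 1)|
            ≤ supNorm (iteratedDeriv 1 h) * |momentDiff (P n) (X n) 1|
              + ∑' j : ℕ, boundTerm h (momentDiff (P n) (X n)) (j + 1) ∧
          supNorm (iteratedDeriv 1 h) * |momentDiff (P n) (X n) 1|
              + ∑' j : ℕ, boundTerm h (momentDiff (P n) (X n)) (j + 1)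
            ≤ K / (n : ℝ) ^ α := by
  refine ⟨2 * (C * ∑' k : ℕ, (k : ℝ) ^ (-δ) / k), fun α _ Ω _ P _ X hX hint _ hε n hn => ?_⟩
  have hb := (summable_rpow_neg_div hδ).mul_left (C / (n : ℝ) ^ α)
  simp only [← mul_div_assoc] at hb
  obtain ⟨hseries, herror, hbound⟩ :=
    mainTheorem5_general hh (hX n hn) (hint n hn) hb (hε n hn)
  refine ⟨hseries, herror, hbound.trans_eq ?_⟩
  simp only [mul_div_assoc, tsum_mul_left]
  ring
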